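/- Let $k$ be a field and let $D$ be a $k$-linear triangulated category (with a set of objects) with suspension $\Sigma$, which is Hom-finite (all $\mathrm{Hom}(X,Y)$ are finite-dimensional over $k$) and Krull–Schmidt (every object is a finite direct sum of indecomposable objects, uniquely up to isomorphism and permutation of the summands). Let $H\subseteq D$ be the heart of a bounded t-structure on $D$, i.e. of a t-structure $(D^{\le n},D^{\ge n})_{n\in\mathbb{Z}}$ such that every object of $D$ lies in $D^{\le n}\cap D^{\ge m}$ for some integers $m,n$; thus $H=D^{\le 0}\cap D^{\ge 0}$ is an abelian category. Let $H^i\colon D\to H$, $H^i(X)=\Sigma^i(\tau^{\ge i}\tau^{\le i}X)$, be the associated cohomology functors. Let $K_0(D)$ and $K_0(H)$ be the Grothendieck groups of the triangulated category $D$ (relations from distinguished triangles) and of the abelian category $H$ (relations from short exact sequences). Call a class of objects finite if it contains only finitely many objects up to isomorphism. * $D$ is cone finite if for all $D_1,D_2\in D$ the class of objects $C$ admitting a distinguished triangle $D_1\to D_2\to C\to\Sigma D_1$ is finite. * $D$ is $H$-discrete if for every function $v\colon\mathbb{Z}\to K_0(D)$ the class of objects $X\in D$ with $[H^i(X)]=v(i)$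 in $K_0(D)$ for all $i\in\mathbb{Z}$ is finite. * $H$ is abelian discrete if for every $c\in K_0(H)$ the class of objects $A\in H$ with $[A]=c$ is finite. * $H$ is modular if for every $A\in H$ the set $\{[A'] : A'\hookrightarrow A \text{ a subobject in } H\}\subseteq K_0(H)$ is finite. Then: (i) If $D$ is cone finite and $H$ is abelian discrete, then $D$ is $H$-discrete. (ii) If $D$ is $H$-discrete, then $H$ is abelian discrete. (iii) If $D$ is $H$-discrete and $H$ is modular, then $D$ is cone finite. -/

import Mathlib

open CategoryTheory CategoryTheory.Limits CategoryTheory.Pretriangulated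
  CategoryTheory.Triangulated

namespace DiscreteTriangulated

universe w v u

section Categories

variable (C : Type u) [Category.{v} C]

/-- A class of objects is finite up to isomorphism: the set of isomorphism classes of its
members is finite. -/
def FiniteUpToIso (P : ObjectProperty C) : Prop :=
  (Quotient.mk (isIsomorphicSetoid C) '' {X : C | P X}).Finite

/-- All homomorphism spaces are finite-dimensional over `k`. -/
def HomFinite (k : Type w) [Field k] [Preadditive C] [Linear k C] : Prop :=
  ∀ X Y : C, Module.Finite k (X ⟶ Y)

/-- Every object is a finite direct sum of indecomposable objects, and such a decomposition
is unique up to permutation and isomorphism of the summands. -/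
structure KrullSchmidt [Preadditive C] [HasFiniteBiproducts C] [HasBinaryBiproducts C] :
    Prop where
  exists_decomposition (X : C) : ∃ (n : ℕ) (Y : Fin n → C),
    (∀ i, Indecomposable (Y i)) ∧ Nonempty (X ≅ ⨁ Y)
  unique_decomposition {n m : ℕ} (Y : Fin n → C) (Z : Fin m → C)
    (hY : ∀ i, Indecomposable (Y i)) (hZ : ∀ j, Indecomposable (Z j))
    (e : Nonempty ((⨁ Y) ≅ ⨁ Z)) :
    ∃ σ : Fin n ≃ Fin m, ∀ i, Nonempty (Y i ≅ Z (σ i))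

end Categories

section AbelianCategories

/- The notions of this section are those of an abelian category `A`. Their definitions only
need the preadditive structure, and they are used for the heart of a t-structure, which is
an abelian category. -/

variable (A : Type u) [Category.{v} A] [Preadditive A]

/-- The Grothendieck group of an abelian category: generated by the objects, with a relation
`[X₂] = [X₁] + [X₃]` for each short exact sequence `0 ⟶ X₁ ⟶ X₂ ⟶ X₃ ⟶ 0`. -/
abbrev AbelianK0 : Type u :=
  FreeAbelianGroup A ⧸ AddSubgroup.closure
    {x : FreeAbelianGroup A | ∃ S : ShortComplex A, S.ShortExact ∧
      x = FreeAbelianGroup.of S.X₂ - (FreeAbelianGroup.of S.X₁ + FreeAbelianGroup.of S.X₃)}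

variable {A} in
/-- The class of an object in the Grothendieck group of an abelian category. -/
def abelianClass (X : A) : AbelianK0 A :=
  QuotientAddGroup.mk (FreeAbelianGroup.of X)

/-- For each `c` in the Grothendieck group, there are only finitely many objects of class `c`,
up to isomorphism. -/
def AbelianDiscrete : Prop :=
  ∀ c : AbelianK0 A, FiniteUpToIso A (fun X => abelianClass X = c)

/-- The subobjects of any given object have only finitely many classes in the Grothendieck
group. -/
def Modular : Prop :=
  ∀ X : A, {c : AbelianK0 A | ∃ (X' : A) (f : X' ⟶ X), Mono f ∧ abelianClass X' = c}.Finite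

end AbelianCategories

section TriangulatedCategories

variable (C : Type u) [Category.{v} C] [Preadditive C] [HasZeroObject C] [HasShift C ℤ]
  [∀ n : ℤ, (shiftFunctor C n).Additive] [Pretriangulated C]

/-- The Grothendieck group of a triangulated category: generated by the objects, with a relation
`[X₂] = [X₁] + [X₃]` for each distinguished triangle `X₁ ⟶ X₂ ⟶ X₃ ⟶ X₁⟦1⟧`. -/
abbrev TriangulatedK0 : Type u :=
  FreeAbelianGroup C ⧸ AddSubgroup.closure
    {x : FreeAbelianGroup C | ∃ T : Triangle C, T ∈ (distTriang C) ∧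
      x = FreeAbelianGroup.of T.obj₂ -
        (FreeAbelianGroup.of T.obj₁ + FreeAbelianGroup.of T.obj₃)}

variable {C} in
/-- The class of an object in the Grothendieck group of a triangulated category. -/
def triangulatedClass (X : C) : TriangulatedK0 C :=
  QuotientAddGroup.mk (FreeAbelianGroup.of X)

/-- For any two objects, the cones of the morphisms between them are finitely many up to
isomorphism. -/
def ConeFinite : Prop :=
  ∀ X Y : C, FiniteUpToIso C (fun Z => ∃ (f : X ⟶ Y) (g : Y ⟶ Z) (h : Z ⟶ X⟦(1 : ℤ)⟧),
    Triangle.mk f g h ∈ distTriang C)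

variable {C}

/-- The t-structure is bounded: every object is `≤ n` for some `n` and `≥ m` for some `m`. -/
def IsBounded (t : TStructure C) : Prop := ∀ X : C, t.bounded X

/-- The heart of a t-structure, as a category. -/
abbrev HeartCat (t : TStructure C) : Type u := t.heart.FullSubcategory

variable [IsTriangulated C]

/-- The cohomology functor `Hⁱ = (τ^{≥ i} τ^{≤ i} -)⟦i⟧` with values in the heart. -/
noncomputable def cohomology (t : TStructure C) (i : ℤ) : C ⥤ HeartCat t :=
  t.heart.lift (t.truncGELE i i ⋙ shiftFunctor C i) (fun X => by
    have h₁ : t.IsLE ((t.truncGELE i i).obj X) i :=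
      inferInstanceAs (t.IsLE ((t.truncGE i).obj ((t.truncLT (i + 1)).obj X)) i)
    have h₂ : t.IsGE ((t.truncGELE i i).obj X) i :=
      inferInstanceAs (t.IsGE ((t.truncGE i).obj _) i)
    exact (t.mem_heart_iff _).2
      ⟨t.isLE_shift ((t.truncGELE i i).obj X) i i 0, t.isGE_shift ((t.truncGELE i i).obj X) i i 0⟩)

/-- The triangulated category is discrete with respect to the heart of `t`: for each function
`v` from the integers to its Grothendieck group, there are only finitely many objects `X`, up to
isomorphism, such that `[Hⁱ(X)] = v i` for all `i`. -/
def HeartDiscrete (t : TStructure C) : Prop :=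
  ∀ v : ℤ → TriangulatedK0 C, FiniteUpToIso C
    (fun X => ∀ i : ℤ, triangulatedClass ((cohomology t i).obj X).obj = v i)

end TriangulatedCategories

end DiscreteTriangulated

/-!
The three implications rest on the cohomology objects of a bounded t-structure and on the
identification of the Grothendieck group of the heart with that of the triangulated category.

The heart is abelian because the cone of a morphism of the heart lies in degrees `-1` and `0`
(`heart_admissibleMorphism`). The functor `H⁰` is homological (`heartH0_isHomological`): a morphism
`y : A ⟶ H⁰(Y)` from the heart is, up to an epimorphism, of the form `H⁰(b)` with `b : B ⟶ Y` and
`B ≤ 0`; if `y` vanishes in `H⁰(Z)`, then `B ⟶ Z` factors through some `M ≤ -1`, and on the fibre of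
`B ⟶ M`, whose `H⁰` surjects onto that of `B`, the morphism `b` lifts to `X`. The long exact
sequence then expresses `[Hⁱ(Z)]` as `[Hⁱ(Y)] - [Hⁱ(X)] + [Kⁱ] + [Kⁱ⁺¹]`, where `Kⁱ` is the kernel
of `Hⁱ(X) ⟶ Hⁱ(Y)` (`exists_subobject_classes`). Taking alternating sums, the terms `Kⁱ` cancel, so
the Euler characteristic is additive and inverts on the classes of the heart the map induced by
the inclusion (`eulerK0Map_triangulatedClass`).

* If the category is cone finite and the heart is discrete, consider the objects with prescribed
  classes of cohomology. A nonzero object of the heart has nonzero class, as otherwise its powers,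
  distinguished by the dimensions of their Hom spaces, would be infinitely many objects of class
  zero (`isZero_of_abelianClass_eq_zero`). Hence the amplitude of these objects is bounded, and
  since `X ≤ n` is a cone of `Hⁿ(X)⟦-n-1⟧ ⟶ τ^{< n} X`, induction on the amplitude leaves
  finitely many of them (`finiteUpToIso_of_amplitude`).
* If the category is discrete with respect to the heart, the objects of the heart of a given class
  have the same cohomology classes, so they are finitely many.
* If moreover the heart is modular, then for fixed `X` and `Y` the classes of the kernels `Kⁱ` take
  finitely many values and vanish for almost all `i`; the cones therefore have finitely many
  families of cohomology classes, and each family is attained by finitely many objects.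
-/

namespace DiscreteTriangulated

open scoped ZeroObject

universe w v u v' u'

/-! ### The heart is an abelian category -/

section Heart

variable {C : Type u} [Category.{v} C] [Preadditive C] [HasZeroObject C] [HasShift C ℤ]
  [∀ n : ℤ, (shiftFunctor C n).Additive] [Pretriangulated C] [IsTriangulated C] (t : TStructure C)

instance heart_isLE (A : HeartCat t) : t.IsLE A.obj 0 := ((t.mem_heart_iff _).1 A.property).1

instance heart_isGE (A : HeartCat t) : t.IsGE A.obj 0 := ((t.mem_heart_iff _).1 A.property).2

instance heart_containsZero : t.heart.ContainsZero where
  exists_zero := ⟨_, isZero_zero C, (t.mem_heart_iff _).2 ⟨inferInstance, inferInstance⟩⟩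

instance heart_isClosedUnderBinaryProducts : t.heart.IsClosedUnderBinaryProducts where
  limitsOfShape_le := by
    rintro X ⟨p⟩
    have h₁ := (t.mem_heart_iff _).1 (p.prop_diag_obj (.mk .left))
    have h₂ := (t.mem_heart_iff _).1 (p.prop_diag_obj (.mk .right))
    have hT := binaryProductTriangle_distinguished (p.diag.obj (.mk .left))
      (p.diag.obj (.mk .right))
    refine t.heart.prop_of_iso ?_ ((t.mem_heart_iff _).2
      ⟨t.isLE₂ _ hT 0 h₁.1 h₂.1, t.isGE₂ _ hT 0 h₁.2 h₂.2⟩)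
    exact IsLimit.conePointUniqueUpToIso (prodIsProd _ _)
      ((IsLimit.postcomposeHomEquiv (diagramIsoPair p.diag) _).2 p.isLimit)

instance heart_isClosedUnderFiniteProducts : t.heart.IsClosedUnderFiniteProducts := .mk'

omit [IsTriangulated C] in
lemma heart_hom_shift_eq_zero ⦃X Y : HeartCat t⦄ ⦃n : ℤ⦄
    (f : t.heart.ι.obj X ⟶ (t.heart.ι.obj Y)⟦n⟧) (hn : n < 0) : f = 0 := by
  have h₁ : t.IsLE (t.heart.ι.obj X) 0 := heart_isLE t X
  have h₂ : t.IsGE (t.heart.ι.obj Y) 0 := heart_isGE t Y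
  exact t.zero_of_isLE_of_isGE f 0 (-n) (by lia) h₁ (t.isGE_shift _ 0 n (-n))

/-- The cone of a morphism of the heart lies in degrees `-1` and `0`; its two truncations are
(up to a shift) the kernel and the cokernel of the morphism. -/
lemma heart_admissibleMorphism :
    AbelianSubcategory.admissibleMorphism t.heart.ι = ⊤ := by
  ext X₁ X₂ f₁
  simp only [MorphismProperty.top_apply, iff_true]
  intro X₃ f₂ f₃ hT
  have h₁ : t.IsLE (t.heart.ι.obj X₁) 0 := heart_isLE t X₁
  have h₁' : t.IsGE (t.heart.ι.obj X₁) 0 := heart_isGE t X₁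
  have h₂ : t.IsLE (t.heart.ι.obj X₂) 0 := heart_isLE t X₂
  have h₂' : t.IsGE (t.heart.ι.obj X₂) 0 := heart_isGE t X₂
  have h₃ : t.IsLE X₃ 0 := t.isLE₂ _ (rot_of_distTriang _ hT) 0 h₂
    (have := t.isLE_shift (t.heart.ι.obj X₁) 0 1 (-1)
     t.isLE_of_le ((t.heart.ι.obj X₁)⟦(1 : ℤ)⟧) (-1) 0)
  have h₃' : t.IsGE X₃ (-1) := t.isGE₂ _ (rot_of_distTriang _ hT) (-1)
    (t.isGE_of_ge (t.heart.ι.obj X₂) (-1) 0) (t.isGE_shift (t.heart.ι.obj X₁) 0 1 (-1))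
  have h₄ : t.IsLE ((t.truncLT 0).obj X₃) (-1) := t.isLE_truncLT_obj X₃ 0 (-1)
  let K : HeartCat t := ⟨((t.truncLT 0).obj X₃)⟦(-1 : ℤ)⟧, (t.mem_heart_iff _).2
    ⟨t.isLE_shift _ (-1) (-1) 0, t.isGE_shift _ (-1) (-1) 0⟩⟩
  let Q : HeartCat t := ⟨(t.truncGE 0).obj X₃, (t.mem_heart_iff _).2
    ⟨inferInstance, inferInstance⟩⟩
  let e : (t.heart.ι.obj K)⟦(1 : ℤ)⟧ ≅ (t.truncLT 0).obj X₃ :=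
    (shiftEquiv C (1 : ℤ)).counitIso.app _
  refine ⟨K, Q, e.hom ≫ (t.truncLTι 0).app X₃, (t.truncGEπ 0).app X₃,
    (t.truncGEδLT 0).app X₃ ≫ e.inv⟦(1 : ℤ)⟧', ?_⟩
  refine isomorphic_distinguished _ (t.triangleLTGE_distinguished 0 X₃) _ ?_
  refine Triangle.isoMk _ _ e (Iso.refl _) (Iso.refl _) (Category.comp_id _)
    ((Category.comp_id _).trans (Category.id_comp _).symm) ?_
  change ((t.truncGEδLT 0).app X₃ ≫ e.inv⟦(1 : ℤ)⟧') ≫ e.hom⟦(1 : ℤ)⟧' =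
    𝟙 _ ≫ (t.truncGEδLT 0).app X₃
  rw [Category.assoc, ← CategoryTheory.Functor.map_comp, e.inv_hom_id,
    CategoryTheory.Functor.map_id]
  exact (Category.comp_id _).trans (Category.id_comp _).symm

/-- The heart of a t-structure is an abelian category. -/
noncomputable instance heartAbelian : Abelian (HeartCat t) :=
  AbelianSubcategory.abelian t.heart.ι (heart_hom_shift_eq_zero t) (heart_admissibleMorphism t)

/-! ### The cohomology functor `H⁰` is homological -/

/-- The functor `H⁰ = τ^{≥ 0} τ^{≤ 0}` with values in the heart. Unlike `cohomology t 0`, it does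
not involve the shift by `0`; see `nonempty_cohomology_iso` for the comparison. -/
noncomputable def heartH0 : C ⥤ HeartCat t :=
  t.heart.lift (t.truncGELE 0 0) (fun X => (t.mem_heart_iff _).2
    ⟨inferInstanceAs (t.IsLE ((t.truncGE 0).obj ((t.truncLE 0).obj X)) 0), inferInstance⟩)

instance : (heartH0 t).Additive where
  map_add {X Y f g} := by
    apply ObjectProperty.hom_ext
    exact (t.truncGELE 0 0).map_add

/-- The natural morphism `τ^{≤ 0} X ⟶ X`. -/
noncomputable def fromLE0 (X : C) : (t.truncLE 0).obj X ⟶ X := (t.truncLEι 0).app X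

instance isIso_fromLE0 (X : C) [t.IsLE X 0] : IsIso (fromLE0 t X) :=
  inferInstanceAs (IsIso ((t.truncLEι 0).app X))

omit [IsTriangulated C] in
lemma fromLE0_naturality {X Y : C} (f : X ⟶ Y) :
    (t.truncLE 0).map f ≫ fromLE0 t Y = fromLE0 t X ≫ f :=
  (t.truncLEι 0).naturality f

/-- The natural morphism `τ^{≤ 0} X ⟶ H⁰(X)`. -/
noncomputable def toH0 (X : C) : (t.truncLE 0).obj X ⟶ ((heartH0 t).obj X).obj :=
  (t.truncGEπ 0).app ((t.truncLE 0).obj X)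

lemma toH0_naturality {X Y : C} (f : X ⟶ Y) :
    toH0 t X ≫ ((heartH0 t).map f).hom = (t.truncLE 0).map f ≫ toH0 t Y :=
  t.truncGEπ_naturality 0 ((t.truncLE 0).map f)

variable {t} in
lemma toH0_hom_ext {X : C} {A : HeartCat t} {f g : (heartH0 t).obj X ⟶ A}
    (h : toH0 t X ≫ f.hom = toH0 t X ≫ g.hom) : f = g := by
  apply ObjectProperty.hom_ext
  exact t.from_truncGE_obj_ext h

/-- The fibre of `τ^{≤ 0} X ⟶ H⁰(X)` is `τ^{< 0} τ^{≤ 0} X`. -/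
lemma exists_distTriang_toH0 (X : C) : ∃ (N : C) (_ : t.IsLE N (-1))
    (i : N ⟶ (t.truncLE 0).obj X) (δ : ((heartH0 t).obj X).obj ⟶ N⟦(1 : ℤ)⟧),
    Triangle.mk i (toH0 t X) δ ∈ distTriang C :=
  ⟨_, t.isLE_truncLT_obj _ 0 (-1), _, _, t.triangleLTGE_distinguished 0 ((t.truncLE 0).obj X)⟩

instance isIso_toH0 (A : HeartCat t) : IsIso (toH0 t A.obj) :=
  inferInstanceAs (IsIso ((t.truncGEπ 0).app ((t.truncLE 0).obj A.obj)))

/-- On the heart, `H⁰` is isomorphic to the identity. -/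
noncomputable def heartH0Iso (A : HeartCat t) : (heartH0 t).obj A.obj ≅ A :=
  t.heart.isoMk ((asIso (toH0 t A.obj)).symm ≪≫ asIso (fromLE0 t A.obj))

lemma toH0_heartH0Iso_hom (A : HeartCat t) :
    toH0 t A.obj ≫ (heartH0Iso t A).hom.hom = fromLE0 t A.obj :=
  IsIso.hom_inv_id_assoc _ _

/-- If `X ⟶ Y ⟶ Z` is distinguished with `Y ≤ 0` and `Z ≤ -1`, then `H⁰(X) ⟶ H⁰(Y)` is
an epimorphism. -/
lemma epi_heartH0_map {X Y Z : C} {f : X ⟶ Y} {g : Y ⟶ Z} {h : Z ⟶ X⟦(1 : ℤ)⟧}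
    (hT : Triangle.mk f g h ∈ distTriang C) [hY : t.IsLE Y 0] [hZ : t.IsLE Z (-1)] :
    Epi ((heartH0 t).map f) := by
  have hX : t.IsLE X 0 := t.isLE₂ _ (inv_rot_of_distTriang _ hT) 0
    (t.isLE_shift Z (-1) (-1) 0) hY
  rw [Preadditive.epi_iff_cancel_zero]
  intro A φ hφ
  have hφ' : toH0 t X ≫ ((heartH0 t).map f).hom ≫ φ.hom = 0 := by
    have : ((heartH0 t).map f).hom ≫ φ.hom = 0 := congr_arg InducedCategory.Hom.hom hφ
    rw [this, comp_zero]
  rw [← Category.assoc, toH0_naturality, Category.assoc] at hφ'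
  have key : f ≫ inv (fromLE0 t Y) ≫ toH0 t Y ≫ φ.hom = 0 := by
    rw [← cancel_epi (fromLE0 t X), comp_zero, ← hφ', ← reassoc_of% fromLE0_naturality,
      IsIso.hom_inv_id_assoc]
  obtain ⟨ψ, hψ⟩ : ∃ ψ : Z ⟶ A.obj, inv (fromLE0 t Y) ≫ toH0 t Y ≫ φ.hom = g ≫ ψ :=
    Triangle.yoneda_exact₂ _ hT _ key
  rw [t.zero ψ (-1) 0, comp_zero] at hψ
  apply toH0_hom_ext
  have : toH0 t Y ≫ φ.hom = 0 := by
    rwa [← cancel_epi (inv (fromLE0 t Y)), comp_zero]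
  rw [this]
  exact comp_zero.symm

/-- A morphism `y : A ⟶ H⁰(Y)` from an object of the heart comes, after pulling back along an
epimorphism `H⁰(B) ⟶ A`, from a morphism `b : B ⟶ Y` with `B ≤ 0`. -/
lemma exists_heartH0_map_eq {A : HeartCat t} {Y : C} (y : A ⟶ (heartH0 t).obj Y) :
    ∃ (B : C) (_ : t.IsLE B 0) (p : (heartH0 t).obj B ⟶ A) (_ : Epi p) (b : B ⟶ Y),
      (heartH0 t).map b = p ≫ y := by
  obtain ⟨N, hN, i, δ, hT⟩ := exists_distTriang_toH0 t Y
  have hN' : t.IsLE (N⟦(1 : ℤ)⟧) (-1) :=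
    have := t.isLE_shift N (-1) 1 (-2)
    t.isLE_of_le _ (-2) (-1)
  -- `B` is the fibre of the obstruction to lifting `y` along `τ^{≤ 0} Y ⟶ H⁰(Y)`.
  obtain ⟨B, e, q, hB⟩ := distinguished_cocone_triangle₁ (y.hom ≫ δ)
  have hB₀ : t.IsLE B 0 := t.isLE₂ _ (inv_rot_of_distTriang _ hB) 0
    (t.isLE_shift (N⟦(1 : ℤ)⟧) (-1) (-1) 0) (heart_isLE t A)
  have he : Epi ((heartH0 t).map e) := epi_heartH0_map t hB
  have hw : (e ≫ y.hom) ≫ δ = 0 :=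
    (Category.assoc _ _ _).trans (comp_distTriang_mor_zero₁₂ _ hB)
  obtain ⟨c, hc⟩ : ∃ c : B ⟶ (t.truncLE 0).obj Y, e ≫ y.hom = c ≫ toH0 t Y :=
    Triangle.coyoneda_exact₃ _ hT _ hw
  refine ⟨B, hB₀, (heartH0 t).map e ≫ (heartH0Iso t A).hom, inferInstance,
    c ≫ fromLE0 t Y, toH0_hom_ext ?_⟩
  have h₁ : (t.truncLE 0).map (c ≫ fromLE0 t Y) = fromLE0 t B ≫ c := by
    apply t.to_truncLE_obj_ext
    change _ ≫ fromLE0 t Y = _ ≫ fromLE0 t Y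
    rw [Category.assoc, fromLE0_naturality]
  have h₂ : (((heartH0 t).map e ≫ (heartH0Iso t A).hom) ≫ y).hom =
      (((heartH0 t).map e).hom ≫ (heartH0Iso t A).hom.hom) ≫ y.hom := rfl
  rw [toH0_naturality, h₁, h₂, Category.assoc, Category.assoc, ← hc,
    ← reassoc_of% fromLE0_naturality, reassoc_of% (toH0_naturality t e), ← toH0_heartH0Iso_hom,
    Category.assoc]

/-- Exactness of `H⁰(X) ⟶ H⁰(Y) ⟶ H⁰(Z)`, up to refinements. -/
lemma exists_heartH0_lift {X Y Z : C} {f : X ⟶ Y} {g : Y ⟶ Z} {h : Z ⟶ X⟦(1 : ℤ)⟧}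
    (hT : Triangle.mk f g h ∈ distTriang C) {A : HeartCat t} (y : A ⟶ (heartH0 t).obj Y)
    (hy : y ≫ (heartH0 t).map g = 0) :
    ∃ (A' : HeartCat t) (p : A' ⟶ A) (_ : Epi p) (x : A' ⟶ (heartH0 t).obj X),
      p ≫ y = x ≫ (heartH0 t).map f := by
  obtain ⟨B, hB, p, hp, b, hb⟩ := exists_heartH0_map_eq t y
  -- `B ⟶ Z` vanishes on `H⁰`, hence factors through an object `M ≤ -1`.
  have h₀ : (heartH0 t).map (b ≫ g) = 0 := by
    rw [CategoryTheory.Functor.map_comp, hb, Category.assoc, hy, comp_zero]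
  have h₁ : (t.truncLE 0).map (b ≫ g) ≫ toH0 t Z = 0 := by
    rw [← toH0_naturality, h₀]
    exact comp_zero
  obtain ⟨M, hM, n, δ, hT'⟩ := exists_distTriang_toH0 t Z
  obtain ⟨m, hm⟩ : ∃ m : (t.truncLE 0).obj B ⟶ M, (t.truncLE 0).map (b ≫ g) = m ≫ n :=
    Triangle.coyoneda_exact₂ _ hT' _ h₁
  have hfac : b ≫ g = (inv (fromLE0 t B) ≫ m) ≫ n ≫ fromLE0 t Z := by
    rw [← cancel_epi (fromLE0 t B), ← fromLE0_naturality, hm]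
    simp only [Category.assoc, IsIso.hom_inv_id_assoc]
  -- Restricted to the fibre `B'` of `B ⟶ M`, the morphism `b` lifts to `X`.
  obtain ⟨B', i, r, hB'⟩ := distinguished_cocone_triangle₁ (inv (fromLE0 t B) ≫ m)
  have hi : Epi ((heartH0 t).map i) := epi_heartH0_map t hB'
  have him : i ≫ inv (fromLE0 t B) ≫ m = 0 := comp_distTriang_mor_zero₁₂ _ hB'
  obtain ⟨x, hx⟩ : ∃ x : B' ⟶ X, i ≫ b = x ≫ f :=
    Triangle.coyoneda_exact₂ _ hT (i ≫ b) (by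
      change (i ≫ b) ≫ g = 0
      rw [Category.assoc, hfac, ← Category.assoc, him, zero_comp])
  refine ⟨_, (heartH0 t).map i ≫ p, inferInstance, (heartH0 t).map x, ?_⟩
  rw [Category.assoc, ← hb, ← CategoryTheory.Functor.map_comp,
    ← CategoryTheory.Functor.map_comp, hx]

/-- The functor `H⁰` is homological. -/
instance heartH0_isHomological : (heartH0 t).IsHomological where
  exact _ hT := (ShortComplex.exact_iff_exact_up_to_refinements _).2
    fun _ y hy => exists_heartH0_lift t hT y hy

end Heart

/-! ### Classes in Grothendieck groups -/

section AbelianClasses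

variable {A : Type u} [Category.{v} A] [Abelian A]

lemma abelianClass_of_shortExact {S : ShortComplex A} (hS : S.ShortExact) :
    abelianClass S.X₂ = abelianClass S.X₁ + abelianClass S.X₃ :=
  (QuotientAddGroup.eq_iff_sub_mem).2 (AddSubgroup.subset_closure ⟨S, hS, rfl⟩)

lemma abelianClass_of_isZero {X : A} (hX : IsZero X) : abelianClass X = 0 := by
  have : (ShortComplex.mk (𝟙 X) (𝟙 X) (hX.eq_of_src _ _)).ShortExact :=
    { exact := ShortComplex.exact_of_isZero_X₂ _ hX }
  simpa using abelianClass_of_shortExact this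

lemma abelianClass_of_iso {X Y : A} (e : X ≅ Y) : abelianClass X = abelianClass Y := by
  have : (ShortComplex.mk e.hom (0 : Y ⟶ 0) comp_zero).ShortExact :=
    { exact := (ShortComplex.exact_iff_epi _ rfl).2 inferInstance
      epi_g := ⟨fun _ _ _ => (isZero_zero A).eq_of_src _ _⟩ }
  simpa [abelianClass_of_isZero (isZero_zero A)] using (abelianClass_of_shortExact this).symm

lemma abelianClass_biprod (X Y : A) :
    abelianClass (X ⊞ Y) = abelianClass X + abelianClass Y :=
  abelianClass_of_shortExact (ShortComplex.Splitting.ofHasBinaryBiproduct X Y).shortExact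

/-- In an exact sequence `X ⟶ Y ⟶ Z`, the image of `X ⟶ Y` is the kernel of `Y ⟶ Z`. -/
lemma abelianClass_of_exact {S : ShortComplex A} (hS : S.Exact) :
    abelianClass S.X₁ = abelianClass (kernel S.f) + abelianClass (kernel S.g) := by
  have hepi : Epi (kernel.lift S.g S.f S.zero) := (S.exact_iff_epi_kernel_lift).1 hS
  have hw : kernel.ι S.f ≫ kernel.lift S.g S.f S.zero = 0 := by
    rw [← cancel_mono (kernel.ι S.g)]; simp
  have hk : (ShortComplex.mk _ _ hw).ShortExact :=
    { exact := ShortComplex.exact_of_f_is_kernel _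
        (KernelFork.IsLimit.ofι _ _ (fun x hx => kernel.lift S.f x (by
            simpa using hx =≫ kernel.ι S.g))
          (fun x hx => kernel.lift_ι _ _ _)
          (fun x hx m hm => by rw [← cancel_mono (kernel.ι S.f), hm, kernel.lift_ι])) }
  exact abelianClass_of_shortExact hk

end AbelianClasses

section TriangulatedClasses

variable {C : Type u} [Category.{v} C] [Preadditive C] [HasZeroObject C] [HasShift C ℤ]
  [∀ n : ℤ, (shiftFunctor C n).Additive] [Pretriangulated C]

lemma triangulatedClass_of_distTriang {T : Triangle C} (hT : T ∈ distTriang C) :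
    triangulatedClass T.obj₂ = triangulatedClass T.obj₁ + triangulatedClass T.obj₃ :=
  (QuotientAddGroup.eq_iff_sub_mem).2 (AddSubgroup.subset_closure ⟨T, hT, rfl⟩)

lemma triangulatedClass_of_isZero {X : C} (hX : IsZero X) : triangulatedClass X = 0 := by
  have hT : Triangle.mk (𝟙 X) (𝟙 X) (0 : X ⟶ X⟦(1 : ℤ)⟧) ∈ distTriang C :=
    isomorphic_distinguished _ (contractible_distinguished X) _
      (Triangle.isoMk _ _ (Iso.refl _) (Iso.refl _) hX.isoZero rfl
        (hX.eq_of_src _ _) (hX.eq_of_src _ _))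
  simpa using triangulatedClass_of_distTriang hT

lemma triangulatedClass_of_iso {X Y : C} (e : X ≅ Y) :
    triangulatedClass X = triangulatedClass Y := by
  have hT : Triangle.mk e.hom (0 : Y ⟶ (0 : C)) 0 ∈ distTriang C :=
    isomorphic_distinguished _ (contractible_distinguished X) _
      (Triangle.isoMk _ _ (Iso.refl _) e.symm (Iso.refl _)
        (e.hom_inv_id.trans (Category.comp_id _).symm)
        ((isZero_zero C).eq_of_tgt _ _) ((isZero_zero C).eq_of_src _ _))
  have h := triangulatedClass_of_distTriang hT
  change triangulatedClass Y = triangulatedClass X + triangulatedClass (0 : C) at h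
  rw [h, triangulatedClass_of_isZero (isZero_zero C), add_zero]

variable [IsTriangulated C] (t : TStructure C)

/-- A short exact sequence of the heart is part of a distinguished triangle. -/
lemma triangulatedClass_of_shortExact {S : ShortComplex (HeartCat t)} (hS : S.ShortExact) :
    triangulatedClass S.X₂.obj = triangulatedClass S.X₁.obj + triangulatedClass S.X₃.obj := by
  have := hS.epi_g
  have := hS.mono_f
  obtain ⟨X₁, i, δ, hT⟩ := AbelianSubcategory.exists_distinguished_triangle_of_epi
    (heart_hom_shift_eq_zero t) (heart_admissibleMorphism t) S.g
  have h₁ := AbelianSubcategory.isLimitKernelForkOfDistTriang (heart_hom_shift_eq_zero t) _ _ _ hT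
  have e : X₁ ≅ S.X₁ := IsLimit.conePointUniqueUpToIso h₁ hS.exact.fIsKernel
  have h₂ : triangulatedClass X₁.obj = triangulatedClass S.X₁.obj :=
    triangulatedClass_of_iso (t.heart.ι.mapIso e)
  rw [← h₂]
  exact triangulatedClass_of_distTriang hT

/-- The homomorphism from the Grothendieck group of the heart to that of the triangulated
category induced by the inclusion. -/
noncomputable def heartK0Map : AbelianK0 (HeartCat t) →+ TriangulatedK0 C :=
  QuotientAddGroup.lift _ (FreeAbelianGroup.lift fun A => triangulatedClass A.obj) (by
    rw [AddSubgroup.closure_le]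
    rintro _ ⟨S, hS, rfl⟩
    simp [triangulatedClass_of_shortExact t hS])

@[simp]
lemma heartK0Map_abelianClass (A : HeartCat t) :
    heartK0Map t (abelianClass A) = triangulatedClass A.obj := by
  simp [heartK0Map, abelianClass]

/-- The long exact sequence of cohomology of a triangle `X ⟶ Y ⟶ Z`, in the Grothendieck group of
the heart: up to the classes of the kernels `K i` of `Hⁱ(X) ⟶ Hⁱ(Y)`, the class of `Hⁱ(Z)` is
`[Hⁱ(Y)] - [Hⁱ(X)]`. -/
lemma exists_subobject_classes {T : Triangle C} (hT : T ∈ distTriang C) :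
    ∃ K : ℤ → HeartCat t, (∀ i, ∃ f : K i ⟶ (heartH0 t).obj (T.obj₁⟦i⟧), Mono f) ∧
      ∀ i, abelianClass ((heartH0 t).obj (T.obj₃⟦i⟧)) =
        abelianClass ((heartH0 t).obj (T.obj₂⟦i⟧)) - abelianClass ((heartH0 t).obj (T.obj₁⟦i⟧))
          + (abelianClass (K i) + abelianClass (K (i + 1))) := by
  let _ : (heartH0 t).ShiftSequence ℤ := .tautological _ _
  refine ⟨fun i => kernel (((heartH0 t).shift i).map T.mor₁),
    fun i => ⟨kernel.ι (((heartH0 t).shift i).map T.mor₁),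
      (inferInstance : Mono (kernel.ι (((heartH0 t).shift i).map T.mor₁)))⟩, fun i => ?_⟩
  have h₁ := abelianClass_of_exact ((heartH0 t).homologySequence_exact₂ T hT i)
  have h₂ := abelianClass_of_exact ((heartH0 t).homologySequence_exact₃ T hT i (i + 1) rfl)
  have h₃ := abelianClass_of_exact ((heartH0 t).homologySequence_exact₁ T hT i (i + 1) rfl)
  change abelianClass ((heartH0 t).obj (T.obj₁⟦i⟧)) = _ at h₁
  change abelianClass ((heartH0 t).obj (T.obj₂⟦i⟧)) = _ at h₂
  change abelianClass ((heartH0 t).obj (T.obj₃⟦i⟧)) = _ at h₃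
  rw [h₁, h₂, h₃]
  dsimp only
  abel

end TriangulatedClasses

/-! ### The Euler characteristic -/

section AlternatingSums

variable {G : Type*} [AddCommGroup G]

/-- The alternating sum of a finitely supported family indexed by the integers (`0` if the
support is infinite). -/
noncomputable def alternatingSum (f : ℤ → G) : G := ∑ᶠ i : ℤ, i.negOnePow • f i

lemma support_negOnePow_smul (f : ℤ → G) :
    (Function.support fun i : ℤ => i.negOnePow • f i) = Function.support f := by
  ext i
  rw [Function.mem_support, Function.mem_support, not_iff_not]
  exact smul_eq_zero_iff_eq _

lemma alternatingSum_add {f g : ℤ → G} (hf : f.support.Finite) (hg : g.support.Finite) :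
    alternatingSum (f + g) = alternatingSum f + alternatingSum g := by
  simp only [alternatingSum, Pi.add_apply, smul_add]
  apply finsum_add_distrib
  · exact (congr_arg Set.Finite (support_negOnePow_smul f)).mpr hf
  · exact (congr_arg Set.Finite (support_negOnePow_smul g)).mpr hg

lemma alternatingSum_shift (f : ℤ → G) :
    alternatingSum (fun i => f (i + 1)) = - alternatingSum f := by
  rw [alternatingSum, alternatingSum, ← finsum_neg_distrib,
    ← finsum_comp_equiv (Equiv.addRight (1 : ℤ)) (f := fun i => -(i.negOnePow • f i))]
  refine finsum_congr fun i => ?_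
  simp [Int.negOnePow_succ]

end AlternatingSums

section Heart

variable {C : Type u} [Category.{v} C] [Preadditive C] [HasZeroObject C] [HasShift C ℤ]
  [∀ n : ℤ, (shiftFunctor C n).Additive] [Pretriangulated C] [IsTriangulated C]
  (t : TStructure C)

variable {t} in
omit [IsTriangulated C] in
lemma isZero_heart_iff {A : HeartCat t} : IsZero A ↔ IsZero A.obj := by
  rw [IsZero.iff_id_eq_zero, IsZero.iff_id_eq_zero]
  exact ⟨fun h => congr_arg InducedCategory.Hom.hom h, fun h => ObjectProperty.hom_ext _ h⟩

lemma isZero_heartH0_of_isLE (X : C) [t.IsLE X (-1)] : IsZero ((heartH0 t).obj X) := by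
  rw [isZero_heart_iff]
  exact t.isZero_truncGE_obj_of_isLE (-1) 0 (by lia) ((t.truncLE 0).obj X)

lemma isZero_heartH0_of_isGE (X : C) [t.IsGE X 1] : IsZero ((heartH0 t).obj X) := by
  rw [isZero_heart_iff]
  exact (t.truncGE 0).map_isZero (t.isZero_truncLE_obj_of_isGE 0 1 (by lia) X)

lemma isZero_heartH0_shift (X : C) (m n : ℤ) [t.IsGE X m] [t.IsLE X n] {i : ℤ}
    (hi : i ∉ Set.Icc m n) : IsZero ((heartH0 t).obj (X⟦i⟧)) := by
  rw [Set.mem_Icc, not_and_or, not_le, not_le] at hi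
  obtain hi | hi := hi
  · have := t.isGE_shift X m i (m - i)
    have := t.isGE_of_ge (X⟦i⟧) 1 (m - i)
    exact isZero_heartH0_of_isGE t _
  · have := t.isLE_shift X n i (n - i)
    have := t.isLE_of_le (X⟦i⟧) (n - i) (-1)
    exact isZero_heartH0_of_isLE t _

variable {t} in
omit [IsTriangulated C] in
lemma IsBounded.exists_isGE_isLE (ht : IsBounded t) (X : C) :
    ∃ m n : ℤ, t.IsGE X m ∧ t.IsLE X n := by
  obtain ⟨⟨m, hm⟩, ⟨n, hn⟩⟩ := ht X
  exact ⟨m, n, hm, hn⟩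

lemma finite_support_heartH0 (ht : IsBounded t) (X : C) :
    (Function.support fun i : ℤ => abelianClass ((heartH0 t).obj (X⟦i⟧))).Finite := by
  obtain ⟨m, n, _, _⟩ := ht.exists_isGE_isLE X
  refine (Set.finite_Icc m n).subset fun i hi => ?_
  by_contra h
  exact hi (abelianClass_of_isZero (isZero_heartH0_shift t X m n h))

/-- The Euler characteristic `X ↦ ∑ (-1)ⁱ [Hⁱ(X)]` is additive on distinguished triangles. -/
lemma alternatingSum_heartH0_of_distTriang (ht : IsBounded t) {T : Triangle C}
    (hT : T ∈ distTriang C) :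
    alternatingSum (fun i => abelianClass ((heartH0 t).obj (T.obj₂⟦i⟧))) =
      alternatingSum (fun i => abelianClass ((heartH0 t).obj (T.obj₁⟦i⟧))) +
        alternatingSum (fun i => abelianClass ((heartH0 t).obj (T.obj₃⟦i⟧))) := by
  obtain ⟨K, hK, h⟩ := exists_subobject_classes t hT
  obtain ⟨m, n, _, _⟩ := ht.exists_isGE_isLE T.obj₁
  have hk : (Function.support fun i : ℤ => abelianClass (K i)).Finite := by
    refine (Set.finite_Icc m n).subset fun i hi => ?_
    by_contra h
    obtain ⟨f, hf⟩ := hK i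
    have hz := isZero_heartH0_shift t T.obj₁ m n h
    exact hi (abelianClass_of_isZero (IsZero.of_mono f hz))
  have hk' : (Function.support fun i : ℤ => abelianClass (K (i + 1))).Finite :=
    hk.preimage (add_left_injective (1 : ℤ)).injOn
  have hsum : (fun i : ℤ => abelianClass ((heartH0 t).obj (T.obj₁⟦i⟧))) +
      (fun i => abelianClass ((heartH0 t).obj (T.obj₃⟦i⟧))) =
      (fun i => abelianClass ((heartH0 t).obj (T.obj₂⟦i⟧))) +
        ((fun i => abelianClass (K i)) + fun i => abelianClass (K (i + 1))) := by
    funext i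
    simp only [Pi.add_apply, h i]
    abel
  have hfin := finite_support_heartH0 t ht
  rw [← alternatingSum_add (hfin _) (hfin _), hsum,
    alternatingSum_add (hfin _) (f := fun i => abelianClass ((heartH0 t).obj (T.obj₂⟦i⟧)))
      (g := (fun i => abelianClass (K i)) + fun i => abelianClass (K (i + 1)))
      ((hk.union hk').subset (Function.support_add
        (fun i => abelianClass (K i)) fun i => abelianClass (K (i + 1)))),
    alternatingSum_add hk hk',
    alternatingSum_shift fun i => abelianClass (K i), add_neg_cancel, add_zero]

/-- For a bounded t-structure, the Euler characteristic as a homomorphism from the Grothendieck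
group of the triangulated category to that of the heart. -/
noncomputable def eulerK0Map (ht : IsBounded t) :
    TriangulatedK0 C →+ AbelianK0 (HeartCat t) :=
  QuotientAddGroup.lift _ (FreeAbelianGroup.lift fun X =>
      alternatingSum fun i => abelianClass ((heartH0 t).obj (X⟦i⟧))) (by
    rw [AddSubgroup.closure_le]
    rintro _ ⟨T, hT, rfl⟩
    simp [alternatingSum_heartH0_of_distTriang t ht hT])

lemma eulerK0Map_triangulatedClass (ht : IsBounded t) (A : HeartCat t) :
    eulerK0Map t ht (triangulatedClass A.obj) = abelianClass A := by
  have h : eulerK0Map t ht (triangulatedClass A.obj) =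
      alternatingSum fun i => abelianClass ((heartH0 t).obj (A.obj⟦i⟧)) := by
    simp [eulerK0Map, triangulatedClass]
  rw [h, alternatingSum, finsum_eq_single _ 0]
  · rw [Int.negOnePow_zero, one_smul]
    exact abelianClass_of_iso
      ((heartH0 t).mapIso ((shiftFunctorZero C ℤ).app A.obj) ≪≫ heartH0Iso t A)
  · intro i hi
    rw [abelianClass_of_isZero (isZero_heartH0_shift t A.obj 0 0 (by simpa using hi)), smul_zero]

/-- For a bounded t-structure, the Grothendieck group of the heart embeds in that of the
triangulated category. -/
lemma abelianClass_eq_iff (ht : IsBounded t) {A B : HeartCat t} :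
    triangulatedClass A.obj = triangulatedClass B.obj ↔ abelianClass A = abelianClass B := by
  refine ⟨fun h => ?_, fun h => ?_⟩
  · rw [← eulerK0Map_triangulatedClass t ht A, h, eulerK0Map_triangulatedClass]
  · rw [← heartK0Map_abelianClass, h, heartK0Map_abelianClass]

omit [IsTriangulated C] in
/-- Truncations commute with shifts, because truncation triangles are unique. -/
lemma nonempty_trunc_shift_iso (X : C) (n a n' : ℤ) (h : a + n' = n) :
    Nonempty (((t.truncLT n).obj X)⟦a⟧ ≅ (t.truncLT n').obj (X⟦a⟧)) ∧
      Nonempty (((t.truncGE n).obj X)⟦a⟧ ≅ (t.truncGE n').obj (X⟦a⟧)) := by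
  obtain ⟨e, -⟩ := t.triangle_iso_exists
    (Triangle.shift_distinguished _ (t.triangleLTGE_distinguished n X) a)
    (t.triangleLTGE_distinguished n' (X⟦a⟧)) (Iso.refl _) (n' - 1) n'
    (t.isLE_shift ((t.truncLT n).obj X) (n - 1) a (n' - 1))
    (t.isGE_shift ((t.truncGE n).obj X) n a n') inferInstance inferInstance
  exact ⟨⟨Triangle.π₁.mapIso e⟩, ⟨Triangle.π₃.mapIso e⟩⟩

/-- `Hⁱ(X)` is `H⁰` of the `i`-th shift of `X`. -/
lemma nonempty_cohomology_iso (X : C) (i : ℤ) :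
    Nonempty ((cohomology t i).obj X ≅ (heartH0 t).obj (X⟦i⟧)) := by
  obtain ⟨e₁⟩ := (nonempty_trunc_shift_iso t X (i + 1) i (0 + 1) (by lia)).1
  obtain ⟨e₂⟩ := (nonempty_trunc_shift_iso t ((t.truncLE i).obj X) i i 0 (by lia)).2
  exact ⟨t.heart.isoMk (e₂ ≪≫ (t.truncGE 0).mapIso e₁)⟩

lemma triangulatedClass_cohomology (X : C) (i : ℤ) :
    triangulatedClass ((cohomology t i).obj X).obj =
      triangulatedClass ((heartH0 t).obj (X⟦i⟧)).obj := by
  obtain ⟨e⟩ := nonempty_cohomology_iso t X i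
  exact triangulatedClass_of_iso (t.heart.ι.mapIso e)

end Heart

/-! ### Classes of objects finite up to isomorphism -/

section FiniteUpToIso

variable {C : Type u} [Category.{v} C]

lemma FiniteUpToIso.mono {P Q : ObjectProperty C} (hQ : FiniteUpToIso C Q)
    (h : ∀ X, P X → Q X) : FiniteUpToIso C P :=
  Set.Finite.subset hQ (Set.image_mono h)

lemma finiteUpToIso_of_subsingleton {P : ObjectProperty C}
    (h : ∀ X Y, P X → P Y → Nonempty (X ≅ Y)) : FiniteUpToIso C P := by
  refine Set.Subsingleton.finite ?_
  rintro _ ⟨X, hX, rfl⟩ _ ⟨Y, hY, rfl⟩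
  exact Quotient.sound (h X Y hX hY)

lemma finiteUpToIso_of_cover {P : ObjectProperty C} {ι : Type*} {T : Set ι} (hT : T.Finite)
    {Q : ι → ObjectProperty C} (hQ : ∀ b ∈ T, FiniteUpToIso C (Q b))
    (h : ∀ X, P X → ∃ b ∈ T, Q b X) : FiniteUpToIso C P := by
  refine (hT.biUnion hQ).subset ?_
  rintro _ ⟨X, hX, rfl⟩
  obtain ⟨b, hb, hX'⟩ := h X hX
  exact Set.mem_biUnion hb ⟨X, hX', rfl⟩

/-- A class of objects which is finite up to isomorphism has a finite set of representatives. -/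
lemma FiniteUpToIso.exists_finite {P : ObjectProperty C} (hP : FiniteUpToIso C P) :
    ∃ S : Set C, S.Finite ∧ ∀ X, P X → ∃ Y ∈ S, Nonempty (X ≅ Y) := by
  refine ⟨Quotient.out '' _, hP.image Quotient.out, fun X hX => ⟨_, ⟨_, ⟨X, hX, rfl⟩, rfl⟩, ?_⟩⟩
  exact (Quotient.mk_out (s := isIsomorphicSetoid C) X).map Iso.symm

lemma FiniteUpToIso.of_fullyFaithful {D : Type u'} [Category.{v'} D] (F : C ⥤ D) [F.Full]
    [F.Faithful] {P : ObjectProperty C} {Q : ObjectProperty D} (hQ : FiniteUpToIso D Q)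
    (h : ∀ X, P X → Q (F.obj X)) : FiniteUpToIso C P := by
  obtain ⟨S, hS, hS'⟩ := hQ.exists_finite
  exact finiteUpToIso_of_cover hS (Q := fun Y X => Nonempty (F.obj X ≅ Y))
    (fun Y _ => finiteUpToIso_of_subsingleton
      fun X X' ⟨e⟩ ⟨e'⟩ => ⟨F.preimageIso (e ≪≫ e'.symm)⟩)
    (fun X hX => hS' _ (h X hX))

end FiniteUpToIso

/-! ### Objects of class zero in a discrete abelian category -/

section AbelianDiscrete

variable {A : Type u} [Category.{v} A] [Abelian A]

/-- The `n`-fold direct sum of an object. -/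
noncomputable def biprodPow (X : A) : ℕ → A
  | 0 => 0
  | n + 1 => X ⊞ biprodPow X n

lemma abelianClass_biprodPow (X : A) (n : ℕ) :
    abelianClass (biprodPow X n) = n • abelianClass X := by
  induction n with
  | zero => rw [zero_smul]; exact abelianClass_of_isZero (isZero_zero A)
  | succ n ih => rw [biprodPow, abelianClass_biprod, ih, succ_nsmul']

variable (k : Type w) [Field k] [Linear k A]

/-- Morphisms to a biproduct are pairs of morphisms, linearly. -/
noncomputable def homBiprodLinearEquiv (W X Y : A) : (W ⟶ X ⊞ Y) ≃ₗ[k] (W ⟶ X) × (W ⟶ Y) where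
  toFun f := (f ≫ biprod.fst, f ≫ biprod.snd)
  invFun p := biprod.lift p.1 p.2
  map_add' f g := by simp
  map_smul' a f := by simp
  left_inv f := by ext <;> simp
  right_inv p := by simp

lemma finrank_hom_biprodPow (hfin : HomFinite A k) (W X : A) (n : ℕ) :
    Module.finrank k (W ⟶ biprodPow X n) = n * Module.finrank k (W ⟶ X) := by
  have := hfin
  induction n with
  | zero =>
    have : Subsingleton (W ⟶ biprodPow X 0) := ⟨fun _ _ => (isZero_zero A).eq_of_tgt _ _⟩
    rw [zero_mul, Module.finrank_zero_of_subsingleton]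
  | succ n ih =>
    have := hfin W X
    have := hfin W (biprodPow X n)
    rw [biprodPow, (homBiprodLinearEquiv k W X (biprodPow X n)).finrank_eq,
      Module.finrank_prod, ih]
    ring

/-- In a Hom-finite abelian category which is discrete, a nonzero object has a nonzero class:
otherwise its powers would be infinitely many objects of class zero. -/
lemma isZero_of_abelianClass_eq_zero (hfin : HomFinite A k) (hd : AbelianDiscrete A) {X : A}
    (hX : abelianClass X = 0) : IsZero X := by
  rw [IsZero.iff_id_eq_zero]
  by_contra h
  have hpos : 0 < Module.finrank k (X ⟶ X) := by
    have := hfin X X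
    have : Nontrivial (X ⟶ X) := ⟨_, _, h⟩
    exact Module.finrank_pos
  have hinj : Function.Injective fun n : ℕ =>
      Quotient.mk (isIsomorphicSetoid A) (biprodPow X n) := by
    intro m n hmn
    obtain ⟨e⟩ : Nonempty (biprodPow X m ≅ biprodPow X n) := Quotient.exact hmn
    have h₁ := (Linear.homCongr k (Iso.refl X) e).finrank_eq
    rw [finrank_hom_biprodPow k hfin, finrank_hom_biprodPow k hfin] at h₁
    exact Nat.eq_of_mul_eq_mul_right hpos h₁
  refine Set.infinite_range_of_injective hinj ((hd 0).subset ?_)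
  rintro _ ⟨n, rfl⟩
  exact ⟨biprodPow X n, by simp [abelianClass_biprodPow, hX], rfl⟩

end AbelianDiscrete

/-! ### Comparison of the finiteness conditions -/

section Heart

variable {C : Type u} [Category.{v} C] [Preadditive C] [HasZeroObject C] [HasShift C ℤ]
  [∀ n : ℤ, (shiftFunctor C n).Additive] [Pretriangulated C]
  (t : TStructure C)

omit [HasZeroObject C] [HasShift C ℤ] [∀ n : ℤ, (shiftFunctor C n).Additive]
  [Pretriangulated C] in
lemma HomFinite.fullSubcategory {k : Type w} [Field k] [Linear k C] (h : HomFinite C k)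
    (P : ObjectProperty C) : HomFinite P.FullSubcategory k := fun X Y =>
  have := h X.obj Y.obj
  Module.Finite.equiv (CategoryTheory.InducedCategory.homLinearEquiv (R := k)).symm

/-- The class of the cones of morphisms `X ⟶ Y` only depends on the isomorphism classes of `X`
and `Y`. -/
lemma exists_distTriang_of_iso {X Y X' Y' Z : C} (e₁ : X ≅ X') (e₂ : Y ≅ Y')
    {f : X ⟶ Y} {g : Y ⟶ Z} {h : Z ⟶ X⟦(1 : ℤ)⟧} (hT : Triangle.mk f g h ∈ distTriang C) :
    ∃ (f' : X' ⟶ Y') (g' : Y' ⟶ Z) (h' : Z ⟶ X'⟦(1 : ℤ)⟧),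
      Triangle.mk f' g' h' ∈ distTriang C := by
  refine ⟨e₁.inv ≫ f ≫ e₂.hom, e₂.inv ≫ g, h ≫ e₁.hom⟦(1 : ℤ)⟧', ?_⟩
  refine isomorphic_distinguished _ hT _
    (Triangle.isoMk _ _ e₁.symm e₂.symm (Iso.refl _) ?_ ?_ ?_)
  · change (e₁.inv ≫ f ≫ e₂.hom) ≫ e₂.inv = e₁.inv ≫ f
    simp
  · exact Category.comp_id _
  · change (h ≫ e₁.hom⟦(1 : ℤ)⟧') ≫ e₁.inv⟦(1 : ℤ)⟧' = 𝟙 _ ≫ h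
    simp [← CategoryTheory.Functor.map_comp]

variable [IsTriangulated C]

lemma heartDiscrete_imp_abelianDiscrete (h : HeartDiscrete t) :
    AbelianDiscrete (HeartCat t) := by
  intro c
  refine (h fun i => if i = 0 then heartK0Map t c else 0).of_fullyFaithful t.heart.ι ?_
  rintro A rfl i
  rw [triangulatedClass_cohomology]
  split_ifs with hi
  · subst hi
    rw [heartK0Map_abelianClass]
    exact triangulatedClass_of_iso (t.heart.ι.mapIso
      ((heartH0 t).mapIso ((shiftFunctorZero C ℤ).app A.obj) ≪≫ heartH0Iso t A))
  · exact triangulatedClass_of_isZero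
      (isZero_heart_iff.1 (isZero_heartH0_shift t A.obj 0 0 (by simpa using hi)))

/-- A family of finite sets, all but finitely many of which have at most one element, has only
finitely many choice functions. -/
lemma finite_setOf_forall_mem {ι β : Type*} (S : ι → Set β) (hS : ∀ i, (S i).Finite)
    (J : Finset ι) (hJ : ∀ i ∉ J, (S i).Subsingleton) : {f : ι → β | ∀ i, f i ∈ S i}.Finite := by
  refine Set.Finite.of_finite_image (f := fun f (j : J) => f j)
    ((Set.Finite.pi' fun j : J => hS j).subset ?_) ?_
  · rintro _ ⟨f, hf, rfl⟩ j
    exact hf j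
  · intro f hf g hg hfg
    funext i
    by_cases hi : i ∈ J
    · exact congr_fun hfg ⟨i, hi⟩
    · exact hJ i hi (hf i) (hg i)

lemma coneFinite_of_heartDiscrete_of_modular (ht : IsBounded t) (h : HeartDiscrete t)
    (hm : Modular (HeartCat t)) : ConeFinite C := by
  intro X Y
  obtain ⟨m, n, _, _⟩ := ht.exists_isGE_isLE X
  -- `S i` is the set of classes of subobjects of `Hⁱ(X)`.
  let S (i : ℤ) : Set (AbelianK0 (HeartCat t)) :=
    {c | ∃ (X' : HeartCat t) (f : X' ⟶ (heartH0 t).obj (X⟦i⟧)), Mono f ∧ abelianClass X' = c}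
  have hS : {κ : ℤ → AbelianK0 (HeartCat t) | ∀ i, κ i ∈ S i}.Finite := by
    refine finite_setOf_forall_mem S (fun i => hm _) (Finset.Icc m n) fun i hi => ?_
    have hz := isZero_heartH0_shift t X m n (i := i) (by simpa using hi)
    rintro _ ⟨A, f, _, rfl⟩ _ ⟨B, g, _, rfl⟩
    rw [abelianClass_of_isZero (IsZero.of_mono f hz), abelianClass_of_isZero (IsZero.of_mono g hz)]
  refine finiteUpToIso_of_cover hS (fun κ _ => h fun i => heartK0Map t
    (abelianClass ((heartH0 t).obj (Y⟦i⟧)) - abelianClass ((heartH0 t).obj (X⟦i⟧)) +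
      (κ i + κ (i + 1)))) ?_
  rintro Z ⟨f, g, δ, hT⟩
  obtain ⟨K, hK, hZ⟩ := exists_subobject_classes t hT
  refine ⟨fun i => abelianClass (K i), fun i => ?_, fun i => ?_⟩
  · obtain ⟨φ, hφ⟩ := hK i
    exact ⟨K i, φ, hφ, rfl⟩
  · rw [triangulatedClass_cohomology, ← heartK0Map_abelianClass]
    exact congr_arg _ (hZ i)

variable {t} in
lemma nonempty_cohomology_iso_of_isLE (X : C) (n : ℤ) [t.IsLE X n] :
    Nonempty (((cohomology t n).obj X).obj ≅ ((t.truncGE n).obj X)⟦n⟧) :=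
  ⟨(t.truncGE n ⋙ shiftFunctor C n).mapIso (asIso ((t.truncLEι n).app X))⟩

variable {t} in
lemma nonempty_cohomology_iso_of_isGE (X : C) (n : ℤ) [t.IsGE X n] :
    Nonempty (((cohomology t n).obj X).obj ≅ ((t.truncLE n).obj X)⟦n⟧) :=
  have : t.IsGE ((t.truncLE n).obj X) n :=
    inferInstanceAs (t.IsGE ((t.truncLT (n + 1)).obj X) n)
  ⟨(shiftFunctor C n).mapIso (asIso ((t.truncGEπ n).app ((t.truncLE n).obj X))).symm⟩

lemma isLE_of_isZero_cohomology (X : C) (n : ℤ) [t.IsLE X n]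
    (h : IsZero ((cohomology t n).obj X)) : t.IsLE X (n - 1) := by
  rw [t.isLE_iff_isZero_truncGE_obj (n - 1) n (by lia)]
  obtain ⟨e⟩ := nonempty_cohomology_iso_of_isLE (t := t) X n
  exact .of_full_of_faithful_of_isZero (shiftFunctor C n) _ ((isZero_heart_iff.1 h).of_iso e.symm)

lemma isGE_of_isZero_cohomology (X : C) (n : ℤ) [t.IsGE X n]
    (h : IsZero ((cohomology t n).obj X)) : t.IsGE X (n + 1) := by
  rw [t.isGE_iff_isZero_truncLE_obj n (n + 1) rfl]
  obtain ⟨e⟩ := nonempty_cohomology_iso_of_isGE (t := t) X n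
  exact .of_full_of_faithful_of_isZero (shiftFunctor C n) _ ((isZero_heart_iff.1 h).of_iso e.symm)

/-- For a bounded t-structure, the cohomology objects detect the bound from above. -/
lemma isLE_of_forall_isZero_cohomology (ht : IsBounded t) (X : C) (n : ℤ)
    (h : ∀ i, n < i → IsZero ((cohomology t i).obj X)) : t.IsLE X n := by
  obtain ⟨-, N, -, hN⟩ := ht.exists_isGE_isLE X
  have key (j : ℕ) : ∀ N : ℤ, N - n ≤ j → t.IsLE X N → t.IsLE X n := by
    induction j with
    | zero => exact fun N hN _ => t.isLE_of_le X N n (by lia)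
    | succ j ih =>
      intro N hN _
      by_cases hn : N ≤ n
      · exact t.isLE_of_le X N n
      · exact ih (N - 1) (by lia) (isLE_of_isZero_cohomology t X N (h N (by lia)))
  exact key (N - n).toNat N (by lia) hN

/-- For a bounded t-structure, the cohomology objects detect the bound from below. -/
lemma isGE_of_forall_isZero_cohomology (ht : IsBounded t) (X : C) (m : ℤ)
    (h : ∀ i, i < m → IsZero ((cohomology t i).obj X)) : t.IsGE X m := by
  obtain ⟨M, -, hM, -⟩ := ht.exists_isGE_isLE X
  have key (j : ℕ) : ∀ M : ℤ, m - M ≤ j → t.IsGE X M → t.IsGE X m := by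
    induction j with
    | zero => exact fun M hM _ => t.isGE_of_ge X m M (by lia)
    | succ j ih =>
      intro M hM _
      by_cases hm : m ≤ M
      · exact t.isGE_of_ge X m M
      · exact ih (M + 1) (by lia) (isGE_of_isZero_cohomology t X M (h M (by lia)))
  exact key (m - M).toNat M (by lia) hM

lemma nonempty_cohomology_truncLT_iso (X : C) (i n : ℤ) (h : i < n) :
    Nonempty ((cohomology t i).obj ((t.truncLT n).obj X) ≅ (cohomology t i).obj X) := by
  have := t.isIso_truncLT_map_truncLTι_app (i + 1) n (by lia) X
  let e : (t.truncLT (i + 1)).obj ((t.truncLT n).obj X) ≅ (t.truncLT (i + 1)).obj X :=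
    @asIso _ _ _ _ _ this
  exact ⟨t.heart.isoMk ((t.truncGE i ⋙ shiftFunctor C i).mapIso e)⟩

/-- An object `X ≤ n` is the cone of a morphism `Hⁿ(X)⟦-n-1⟧ ⟶ τ^{< n} X`. -/
lemma exists_distTriang_truncLT (X : C) (n : ℤ) [t.IsLE X n] :
    ∃ (f : ((cohomology t n).obj X).obj⟦-n⟧⟦(-1 : ℤ)⟧ ⟶ (t.truncLT n).obj X)
      (g : (t.truncLT n).obj X ⟶ X)
      (h : X ⟶ (((cohomology t n).obj X).obj⟦-n⟧⟦(-1 : ℤ)⟧)⟦(1 : ℤ)⟧),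
      Triangle.mk f g h ∈ distTriang C := by
  obtain ⟨e⟩ := nonempty_cohomology_iso_of_isLE (t := t) X n
  exact exists_distTriang_of_iso
    ((shiftFunctor C (-1 : ℤ)).mapIso ((shiftFunctor C (-n)).mapIso e ≪≫
      (shiftEquiv C n).unitIso.symm.app ((t.truncGE n).obj X)).symm) (Iso.refl _)
    (inv_rot_of_distTriang _ (t.triangleLTGE_distinguished n X))

/-- In a cone finite triangulated category, the objects of bounded amplitude whose cohomology
objects belong to given finite classes are finitely many: by induction on the amplitude, such an
object is the cone of a morphism between two objects for which finitely many choices exist. -/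
lemma finiteUpToIso_of_amplitude (hc : ConeFinite C) {v : ℤ → TriangulatedK0 C}
    (hv : ∀ i, FiniteUpToIso (HeartCat t) fun A => triangulatedClass A.obj = v i)
    (m : ℤ) (n : ℕ) :
    FiniteUpToIso C fun X => t.IsGE X m ∧ t.IsLE X (m + n - 1) ∧
      ∀ i, i < m + n → triangulatedClass ((cohomology t i).obj X).obj = v i := by
  induction n with
  | zero =>
    refine finiteUpToIso_of_subsingleton ?_
    rintro X Y ⟨_, _, -⟩ ⟨_, _, -⟩
    exact ⟨(t.isZero X (m + (0 : ℕ) - 1) m).iso (t.isZero Y (m + (0 : ℕ) - 1) m)⟩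
  | succ n ih =>
    obtain ⟨S, hS, hS'⟩ := ih.exists_finite
    obtain ⟨R, hR, hR'⟩ := (hv (m + n)).exists_finite
    refine finiteUpToIso_of_cover (hR.prod hS)
      (fun p _ => hc (p.1.obj⟦-(m + n)⟧⟦(-1 : ℤ)⟧) p.2) ?_
    rintro X ⟨_, hX, hXv⟩
    have : t.IsLE X (m + n) := t.isLE_of_le X (m + (n + 1 : ℕ) - 1) _
    obtain ⟨f, g, h, hT⟩ := exists_distTriang_truncLT t X (m + n)
    obtain ⟨A, hA, ⟨e₁⟩⟩ := hR' ((cohomology t (m + n)).obj X) (hXv _ (by lia))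
    obtain ⟨Y, hY, ⟨e₂⟩⟩ := hS' ((t.truncLT (m + n)).obj X)
      ⟨inferInstance, inferInstance, fun i hi => by
        obtain ⟨e⟩ := nonempty_cohomology_truncLT_iso t X i (m + n) hi
        exact (triangulatedClass_of_iso (t.heart.ι.mapIso e)).trans (hXv i (by lia))⟩
    exact ⟨(A, Y), ⟨hA, hY⟩, exists_distTriang_of_iso
      ((t.heart.ι ⋙ shiftFunctor C (-(m + n : ℤ)) ⋙ shiftFunctor C (-1 : ℤ)).mapIso e₁) e₂ hT⟩

lemma heartDiscrete_of_coneFinite_of_abelianDiscrete (ht : IsBounded t) {k : Type w} [Field k]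
    [Linear k C] (hfin : HomFinite C k) (hc : ConeFinite C) (hd : AbelianDiscrete (HeartCat t)) :
    HeartDiscrete t := by
  intro v
  by_cases hne : ∃ X₀ : C, ∀ i, triangulatedClass ((cohomology t i).obj X₀).obj = v i
  swap
  · exact finiteUpToIso_of_subsingleton fun X _ hX => (hne ⟨X, hX⟩).elim
  obtain ⟨X₀, hX₀⟩ := hne
  obtain ⟨m, n, _, _⟩ := ht.exists_isGE_isLE X₀
  have hclass {A : HeartCat t} {i : ℤ} (hA : triangulatedClass A.obj = v i) :
      abelianClass A = abelianClass ((cohomology t i).obj X₀) :=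
    (abelianClass_eq_iff t ht).1 (hA.trans (hX₀ i).symm)
  have hv (i : ℤ) : FiniteUpToIso (HeartCat t) fun A => triangulatedClass A.obj = v i :=
    (hd (abelianClass ((cohomology t i).obj X₀))).mono fun A hA => hclass hA
  -- The support of `v` is bounded, so that the objects of class `v` have bounded amplitude.
  have hz (X : C) (hX : ∀ i, triangulatedClass ((cohomology t i).obj X).obj = v i) (i : ℤ)
      (hi : i ∉ Set.Icc m n) : IsZero ((cohomology t i).obj X) := by
    refine isZero_of_abelianClass_eq_zero k (hfin.fullSubcategory t.heart) hd ?_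
    obtain ⟨e⟩ := nonempty_cohomology_iso t X₀ i
    rw [hclass (hX i), abelianClass_of_iso e,
      abelianClass_of_isZero (isZero_heartH0_shift t X₀ m n hi)]
  refine (finiteUpToIso_of_amplitude t hc hv m (n + 1 - m).toNat).mono fun X hX => ⟨?_, ?_, ?_⟩
  · exact isGE_of_forall_isZero_cohomology t ht X m fun i hi => hz X hX i (by simp; lia)
  · have := isLE_of_forall_isZero_cohomology t ht X n fun i hi => hz X hX i (by simp; lia)
    exact t.isLE_of_le X n _
  · exact fun i _ => hX i

end Heart

end DiscreteTriangulated

theorem mainTheorem1 {k : Type*} [Field k] {D : Type*} [Category* D]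
    [Preadditive D] [Linear k D] [HasZeroObject D] [HasShift D ℤ]
    [∀ n : ℤ, (shiftFunctor D n).Additive] [Pretriangulated D] [IsTriangulated D]
    (hfin : DiscreteTriangulated.HomFinite D k)
    (hKS : DiscreteTriangulated.KrullSchmidt D)
    (t : TStructure D) (ht : DiscreteTriangulated.IsBounded t) :
    (DiscreteTriangulated.ConeFinite D →
      DiscreteTriangulated.AbelianDiscrete (DiscreteTriangulated.HeartCat t) →
      DiscreteTriangulated.HeartDiscrete t) ∧
    (DiscreteTriangulated.HeartDiscrete t →
      DiscreteTriangulated.AbelianDiscrete (DiscreteTriangulated.HeartCat t)) ∧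
    (DiscreteTriangulated.HeartDiscrete t →
      DiscreteTriangulated.Modular (DiscreteTriangulated.HeartCat t) →
      DiscreteTriangulated.ConeFinite D) := by
  exact ⟨DiscreteTriangulated.heartDiscrete_of_coneFinite_of_abelianDiscrete t ht hfin,
    DiscreteTriangulated.heartDiscrete_imp_abelianDiscrete t,
    DiscreteTriangulated.coneFinite_of_heartDiscrete_of_modular t ht⟩
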